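/- Let $(M,\varphi,\xi,\eta,g)$ be a non-empty smooth $3$-dimensional almost contact metric manifold, i.e. $g$ is a Riemannian metric, $\varphi$ a $(1,1)$-tensor field, $\xi$ a vector field and $\eta$ a $1$-form, all smooth, with $$\varphi^2=-I+\eta\otimes\xi,\quad \eta(\xi)=1,\quad \eta\circ\varphi=0,\quad \varphi(\xi)=0,\quad \eta(X)=g(X,\xi),\quad g(\varphi X,\varphi Y)=g(X,Y)-\eta(X)\eta(Y).$$ Assume that it is $\beta$-Kenmotsu for a constant $\beta>0$: with $\nabla$ the Levi-Civita connection of $g$, $$(\nabla_X\varphi)(Y)=\beta\,\bigl(g(\varphi X,Y)\,\xi-\eta(Y)\,\varphi X\bigr)$$ for all vector fields $X,Y$. Let $S$ be the Ricci tensor, $r$ the scalar curvature and $\lambda$ a real number. (a) If $(g,\xi,\lambda)$ is a Ricci soliton, that is, $\mathcal{L}_\xi g+2S+2\lambda g=0$ on $M$, then it is expanding (that is, $\lambda>0$), $\lambda=2\beta^2$, and $r$ is constant. (b) More precisely, at every single point $p\in M$ at which the equation $\mathcal{L}_\xi g+2S+2\lambda g=0$ holds, one has $\lambda=2\beta^2$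 and $r(p)=-6\beta^2-2\beta$. -/

import Mathlib

open Bundle Manifold
open scoped ContDiff

namespace Kenmotsu

noncomputable section

variable {E : Type*} [NormedAddCommGroup E] [NormedSpace ℝ E] [FiniteDimensional ℝ E]
  {H : Type*} [TopologicalSpace H] {I : ModelWithCorners ℝ E H}
  {M : Type*} [TopologicalSpace M] [ChartedSpace H M] [IsManifold I ∞ M]
  [RiemannianBundle (fun x : M ↦ TangentSpace I x)]
  [IsContMDiffRiemannianBundle I ∞ E (fun x : M ↦ TangentSpace I x)]

/-- `cov` is the Levi-Civita connection of the Riemannian metric `⟪·, ·⟫` of `M`: a smooth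
connection on `TM` that is metric and torsion-free.  In Mathlib's argument order `cov Y x v` is
`(∇_v Y)(x)`. -/
structure IsLeviCivita
    (cov : CovariantDerivative I E (fun x : M ↦ TangentSpace I x)) : Prop where
  smooth : CovariantDerivative.ContMDiffCovariantDerivative cov ∞
  metric : CovariantDerivative.IsMetricCompatible (F := E) (V := fun x : M ↦ TangentSpace I x) cov
  torsion_free : cov.torsion = 0

/-- The curvature `R(X, Y) Z = ∇_X ∇_Y Z - ∇_Y ∇_X Z - ∇_[X, Y] Z` at the point `x`. -/
def curvature (cov : CovariantDerivative I E (fun x : M ↦ TangentSpace I x))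
    (X Y Z : Π x : M, TangentSpace I x) (x : M) : TangentSpace I x :=
  cov (fun y ↦ cov Z y (Y y)) x (X x) - cov (fun y ↦ cov Z y (X y)) x (Y x)
    - cov Z x (VectorField.mlieBracket I X Y x)

/-- The Ricci tensor `S(v, w) = tr (u ↦ R(u, v) w)` at the point `x`, the trace being computed in
an orthonormal basis of `T_x M`.  The curvature at `x` only depends on the values at `x` of the
vector fields, so tangent vectors are extended to vector fields that are smooth near `x`
(constant in a local trivialization of `TM`). -/
def ricci (cov : CovariantDerivative I E (fun x : M ↦ TangentSpace I x))
    (x : M) (v w : TangentSpace I x) : ℝ :=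
  haveI : FiniteDimensional ℝ (TangentSpace I x) := inferInstanceAs (FiniteDimensional ℝ E)
  let e := stdOrthonormalBasis ℝ (TangentSpace I x)
  ∑ i, inner ℝ
    (curvature cov (FiberBundle.extend E (e i)) (FiberBundle.extend E v)
      (FiberBundle.extend E w) x) (e i)

/-- The scalar curvature: the trace of the Ricci tensor with respect to the metric. -/
def scalarCurvature (cov : CovariantDerivative I E (fun x : M ↦ TangentSpace I x))
    (x : M) : ℝ :=
  haveI : FiniteDimensional ℝ (TangentSpace I x) := inferInstanceAs (FiniteDimensional ℝ E)
  let e := stdOrthonormalBasis ℝ (TangentSpace I x)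
  ∑ i, ricci cov x (e i) (e i)

/-- The Lie derivative of the metric,
`(L_V g)(X, Y) = V (g(X, Y)) - g([V, X], Y) - g(X, [V, Y])`, at the point `x` and on the tangent
vectors `v` and `w`; it is a tensor, so `v` and `w` are extended to vector fields that are smooth
near `x`. -/
def lieDerivMetric (V : Π x : M, TangentSpace I x) (x : M) (v w : TangentSpace I x) : ℝ :=
  let X : Π y : M, TangentSpace I y := FiberBundle.extend E v
  let Y : Π y : M, TangentSpace I y := FiberBundle.extend E w
  mvfderiv I (fun y ↦ (inner ℝ (X y) (Y y) : ℝ)) x (V x)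
    - inner ℝ (VectorField.mlieBracket I V X x) w
    - inner ℝ v (VectorField.mlieBracket I V Y x)

/-- The equation `L_V g + 2 S + 2 λ g = 0` at the point `x`. -/
def RicciSolitonEquationAt (cov : CovariantDerivative I E (fun x : M ↦ TangentSpace I x))
    (V : Π x : M, TangentSpace I x) (lam : ℝ) (x : M) : Prop :=
  ∀ v w : TangentSpace I x,
    lieDerivMetric V x v w + 2 * ricci cov x v w + 2 * lam * inner ℝ v w = 0

/-- `(g, V, λ)` is a Ricci soliton, where `g` is the metric of `M` and `cov` its Levi-Civita
connection. -/
structure IsRicciSoliton (cov : CovariantDerivative I E (fun x : M ↦ TangentSpace I x))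
    (V : Π x : M, TangentSpace I x) (lam : ℝ) : Prop where
  leviCivita : IsLeviCivita cov
  smooth : ContMDiff I I.tangent ∞ (fun x ↦ (⟨x, V x⟩ : TangentBundle I M))
  equation : ∀ x, RicciSolitonEquationAt cov V lam x

/-- A Ricci soliton `(g, V, λ)` is expanding if `λ` is positive. -/
def IsExpanding (lam : ℝ) : Prop := 0 < lam

/-- `(φ, ξ, η, g)` is a smooth almost contact metric structure, `g` being the metric of `M`. -/
structure IsAlmostContactMetric
    (φ : Π x : M, TangentSpace I x →L[ℝ] TangentSpace I x)
    (ξ : Π x : M, TangentSpace I x)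
    (η : Π x : M, TangentSpace I x →L[ℝ] ℝ) : Prop where
  smooth_phi : ContMDiff I (I.prod 𝓘(ℝ, E →L[ℝ] E)) ∞
    (fun x ↦ TotalSpace.mk' (E →L[ℝ] E)
      (E := fun x : M ↦ TangentSpace I x →L[ℝ] TangentSpace I x) x (φ x))
  smooth_xi : ContMDiff I I.tangent ∞ (fun x ↦ (⟨x, ξ x⟩ : TangentBundle I M))
  smooth_eta : ContMDiff I (I.prod 𝓘(ℝ, E →L[ℝ] ℝ)) ∞
    (fun x ↦ TotalSpace.mk' (E →L[ℝ] ℝ)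
      (E := fun x : M ↦ TangentSpace I x →L[ℝ] Bundle.Trivial M ℝ x) x (η x))
  phi_phi : ∀ x (v : TangentSpace I x), φ x (φ x v) = -v + η x v • ξ x
  eta_xi : ∀ x, η x (ξ x) = 1
  eta_phi : ∀ x (v : TangentSpace I x), η x (φ x v) = 0
  phi_xi : ∀ x, φ x (ξ x) = 0
  eta_eq : ∀ x (v : TangentSpace I x), η x v = inner ℝ v (ξ x)
  inner_phi_phi : ∀ x (v w : TangentSpace I x),
    inner ℝ (φ x v) (φ x w) = inner ℝ v w - η x v * η x w

/-- `(M, φ, ξ, η, g)` is an `f`-Kenmotsu manifold; `cov` is the Levi-Civita connection of `g` and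
`(∇_v φ) Y = ∇_v (φ Y) - φ (∇_v Y)`
for tangent vectors `v` and smooth vector fields `Y`. -/
structure IsFKenmotsu (cov : CovariantDerivative I E (fun x : M ↦ TangentSpace I x))
    (φ : Π x : M, TangentSpace I x →L[ℝ] TangentSpace I x)
    (ξ : Π x : M, TangentSpace I x)
    (η : Π x : M, TangentSpace I x →L[ℝ] ℝ) (f : M → ℝ) : Prop where
  almostContact : IsAlmostContactMetric φ ξ η
  leviCivita : IsLeviCivita cov
  smooth : ContMDiff I 𝓘(ℝ, ℝ) ∞ f
  pos : ∀ x, 0 < f x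
  df_wedge_eta : ∀ x (v w : TangentSpace I x),
    mvfderiv I f x v * η x w - mvfderiv I f x w * η x v = 0
  covDeriv_phi : ∀ (Y : Π x : M, TangentSpace I x),
    ContMDiff I I.tangent ∞ (fun x ↦ (⟨x, Y x⟩ : TangentBundle I M)) →
    ∀ x (v : TangentSpace I x), cov (fun y ↦ φ y (Y y)) x v - φ x (cov Y x v)
      = f x • ((inner ℝ (φ x v) (Y x) : ℝ) • ξ x - η x (Y x) • φ x v)

/-- A `β`-Kenmotsu manifold is an `f`-Kenmotsu manifold whose function `f` is a constant `β`
(which is positive since `f` is). -/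
def IsBetaKenmotsu (cov : CovariantDerivative I E (fun x : M ↦ TangentSpace I x))
    (φ : Π x : M, TangentSpace I x →L[ℝ] TangentSpace I x)
    (ξ : Π x : M, TangentSpace I x)
    (η : Π x : M, TangentSpace I x →L[ℝ] ℝ) (β : ℝ) : Prop :=
  IsFKenmotsu cov φ ξ η (fun _ ↦ β)

end

end Kenmotsu

open Filter Topology VectorField

namespace Kenmotsu

/-! Everything follows from the formula `∇_v ξ = β (v - η(v) ξ)` (`IsFKenmotsu.cov_xi`). It gives
`L_ξ g = 2β (g - η ⊗ η)` and, differentiated once more, `R(X, Y) ξ = β² (η(X) Y - η(Y) X)`, whence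
`S(v, ξ) = -(n - 1) β² η(v)` with `n = dim M`. At `(ξ, ξ)` the Lie derivative vanishes, so the
soliton equation leaves `λ = (n - 1) β²`; its trace then yields `r = -(n - 1) β - n λ`. Both are
pointwise, and `n = 3` gives the claim. The delicate point is that `ricci` extends `ξ x` by a field
other than `ξ`. Skew-adjointness of the curvature (`IsLeviCivita.inner_curvature`) shows that the
choice of extension does not matter. -/

theorem mvfderiv_congr {E : Type*} [NormedAddCommGroup E] [NormedSpace ℝ E]
    {H : Type*} [TopologicalSpace H] {I : ModelWithCorners ℝ E H}
    {M : Type*} [TopologicalSpace M] [ChartedSpace H M] {x : M}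
    {f g : M → ℝ} (h : f =ᶠ[𝓝 x] g) (v : TangentSpace I x) :
    mvfderiv I f x v = mvfderiv I g x v := by
  simp only [mvfderiv, h.mfderiv_eq]
  rfl

/-! ### Vector fields smooth near a point, and the bracket as a commutator. -/

section SmoothNear

variable {E : Type*} [NormedAddCommGroup E] [NormedSpace ℝ E]
  {H : Type*} [TopologicalSpace H] {I : ModelWithCorners ℝ E H}
  {M : Type*} [TopologicalSpace M] [ChartedSpace H M] [IsManifold I ∞ M]

/-- The vector field `X` is smooth on a neighbourhood of `x`. -/
def SmoothNear (X : Π x : M, TangentSpace I x) (x : M) : Prop :=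
  ∀ᶠ y in 𝓝 x, CMDiffAt ∞ (T% X) y

variable {X Y Z : Π x : M, TangentSpace I x} {x : M}

theorem SmoothNear.contMDiffAt (h : SmoothNear X x) : CMDiffAt ∞ (T% X) x :=
  h.self_of_nhds

theorem SmoothNear.mdifferentiableAt (h : SmoothNear X x) : MDiffAt (T% X) x :=
  h.contMDiffAt.mdifferentiableAt (by simp)

theorem SmoothNear.eventually (h : SmoothNear X x) : ∀ᶠ y in 𝓝 x, SmoothNear X y :=
  eventually_eventually_nhds.2 h

theorem smoothNear_of_contMDiff (h : CMDiff ∞ (T% X)) (x : M) : SmoothNear X x :=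
  Eventually.of_forall fun y ↦ h y

theorem smoothNear_extend {x : M} (v : TangentSpace I x) :
    SmoothNear (FiberBundle.extend E v) x := by
  obtain ⟨s, hs, h⟩ := FiberBundle.exists_contMDiffOn_extend (k := ∞) I E v
  filter_upwards [eventually_mem_nhds_iff.2 hs] with y hy
  exact h.contMDiffAt hy

/-- A vector field that is smooth near `x` coincides near `x` with a globally smooth one. -/
theorem SmoothNear.exists_contMDiff_eventuallyEq [FiniteDimensional ℝ E] [T2Space M]
    (h : SmoothNear X x) :
    ∃ X' : Π x : M, TangentSpace I x, CMDiff ∞ (T% X') ∧ ∀ᶠ y in 𝓝 x, X' y = X y := by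
  obtain ⟨u, hu, huo, hxu⟩ := eventually_nhds_iff.1 h
  obtain ⟨f, -, hf⟩ := (SmoothBumpFunction.nhds_basis_tsupport (I := I) x).mem_iff.1
    (huo.mem_nhds hxu)
  refine ⟨(f : M → ℝ) • X, ?_, ?_⟩
  · exact ContMDiffOn.smul_section_of_tsupport f.contMDiff.contMDiffOn huo hf
      fun y hy ↦ (hu y hy).contMDiffWithinAt
  · filter_upwards [f.eventuallyEq_one] with y hy
    simp [hy]

/-- The Lie bracket of vector fields is the commutator of the derivations they define. -/
theorem mvfderiv_comm [FiniteDimensional ℝ E] [Nontrivial E]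
    (hX : SmoothNear X x) (hY : SmoothNear Y x)
    {f : M → ℝ} (hf : CMDiffAt ∞ f x)
    (hXf : MDiffAt (fun y ↦ mvfderiv I f y (X y)) x)
    (hYf : MDiffAt (fun y ↦ mvfderiv I f y (Y y)) x) :
    mvfderiv I (fun y ↦ mvfderiv I f y (Y y)) x (X x)
      - mvfderiv I (fun y ↦ mvfderiv I f y (X y)) x (Y x)
      = mvfderiv I f x (mlieBracket I X Y x) := by
  have : IsManifold I (minSmoothness ℝ 3) M := by
    simp only [minSmoothness_of_isRCLikeNormedField]; infer_instance
  have hcompl : CompleteSpace E := FiniteDimensional.complete ℝ E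
  -- The Jacobi identity is applied to `X`, `Y`, `f • Z` with `Z x ≠ 0`. After subtracting `f x`
  -- times the identity for `Z`, the mixed terms cancel and the coefficient of `Z x` is the claim.
  obtain ⟨v, hv⟩ := exists_ne (0 : E)
  let Z : Π y : M, TangentSpace I y := FiberBundle.extend E (show TangentSpace I x from v)
  have hZx : Z x = v := FiberBundle.extend_apply_self E _
  have hZ : SmoothNear Z x := smoothNear_extend _
  have hfnear : ∀ᶠ y in 𝓝 x, MDiffAt f y := by
    have h1 : CMDiffAt 1 f x := hf.of_le (by simp)
    filter_upwards [(contMDiffAt_iff_contMDiffAt_nhds (by simp)).1 h1] with y hy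
    exact hy.mdifferentiableAt one_ne_zero
  -- Equality near `x`, not only at `x`, because this field is bracketed again.
  have key : ∀ {W : Π y : M, TangentSpace I y},
      mlieBracket I W (f • Z) =ᶠ[𝓝 x]
        ((fun y ↦ mvfderiv I f y (W y)) • Z + f • mlieBracket I W Z) := by
    intro W
    filter_upwards [hfnear, hZ.eventually] with y hfy hZy
    rw [mlieBracket_smul_right hfy hZy.mdifferentiableAt]
    rfl
  have two : ∀ {W : Π y : M, TangentSpace I y}, CMDiffAt ∞ (T% W) x →
      CMDiffAt (minSmoothness ℝ 2) (T% W) x := by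
    intro W hW
    rw [minSmoothness_of_isRCLikeNormedField]
    exact hW.of_le (by norm_cast)
  have hbr : ∀ {W : Π y : M, TangentSpace I y}, SmoothNear W x →
      MDiffAt (T% (mlieBracket I W Z)) x := by
    intro W hW
    have : IsManifold I ((2 : ℕ∞) + 1) M :=
      inferInstanceAs (IsManifold I (((2 : ℕ∞) + 1 : ℕ∞) : WithTop ℕ∞) M)
    have : CMDiffAt (1 : ℕ∞) (T% (mlieBracket I W Z)) x :=
      ContMDiffAt.mlieBracket_vectorField (n := (2 : ℕ∞))
        (hW.contMDiffAt.of_le (by norm_cast))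
        (hZ.contMDiffAt.of_le (by norm_cast))
        (by rw [minSmoothness_of_isRCLikeNormedField]; norm_num)
    exact this.mdifferentiableAt (by simp)
  have hfx : MDiffAt f x := hfnear.self_of_nhds
  have hJf := leibniz_identity_mlieBracket_apply (two hX.contMDiffAt) (two hY.contMDiffAt)
    (two (hf.smul_section hZ.contMDiffAt))
  have hJ := leibniz_identity_mlieBracket_apply (two hX.contMDiffAt) (two hY.contMDiffAt)
    (two hZ.contMDiffAt)
  have expand : ∀ {V W : Π y : M, TangentSpace I y}, SmoothNear W x →
      MDiffAt (fun y ↦ mvfderiv I f y (W y)) x →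
      mlieBracket I V (mlieBracket I W (f • Z)) x =
        mvfderiv I (fun y ↦ mvfderiv I f y (W y)) x (V x) • Z x
          + mvfderiv I f x (W x) • mlieBracket I V Z x
          + (mvfderiv I f x (V x) • mlieBracket I W Z x
          + f x • mlieBracket I V (mlieBracket I W Z) x) := by
    intro V W hW hWf
    rw [(EventuallyEq.refl _ V).mlieBracket_vectorField_eq key,
      mlieBracket_add_right (hWf.smul_section hZ.mdifferentiableAt)
        (hfx.smul_section (hbr hW)),
      mlieBracket_smul_right hWf hZ.mdifferentiableAt, mlieBracket_smul_right hfx (hbr hW)]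
  rw [expand hY hYf, expand hX hXf, mlieBracket_smul_right hfx hZ.mdifferentiableAt, hJ] at hJf
  have h0 : (mvfderiv I (fun y ↦ mvfderiv I f y (Y y)) x (X x)
      - mvfderiv I (fun y ↦ mvfderiv I f y (X y)) x (Y x)
      - mvfderiv I f x (mlieBracket I X Y x)) • Z x = 0 := by
    rw [← sub_eq_zero] at hJf
    rw [← hJf]
    module
  rcases smul_eq_zero.1 h0 with h | h
  · exact sub_eq_zero.1 h
  · exact absurd (hZx.symm.trans h) hv

end SmoothNear

theorem mdifferentiableAt_inner {E : Type*} [NormedAddCommGroup E] [NormedSpace ℝ E]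
    {H : Type*} [TopologicalSpace H] {I : ModelWithCorners ℝ E H}
    {M : Type*} [TopologicalSpace M] [ChartedSpace H M] [IsManifold I ∞ M]
    [RiemannianBundle (fun x : M ↦ TangentSpace I x)]
    [IsContMDiffRiemannianBundle I ∞ E (fun x : M ↦ TangentSpace I x)]
    {Z W : Π x : M, TangentSpace I x} {x : M}
    (hZ : MDiffAt (T% Z) x) (hW : MDiffAt (T% W) x) :
    MDiffAt (fun y ↦ (inner ℝ (Z y) (W y) : ℝ)) x :=
  MDifferentiableAt.inner_bundle (F := E) (E := fun x : M ↦ TangentSpace I x) hZ hW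

/-! ### Levi-Civita connection: metric, curvature and Lie derivative. -/

section LeviCivita

variable {E : Type*} [NormedAddCommGroup E] [NormedSpace ℝ E] [FiniteDimensional ℝ E]
  {H : Type*} [TopologicalSpace H] {I : ModelWithCorners ℝ E H}
  {M : Type*} [TopologicalSpace M] [ChartedSpace H M] [IsManifold I ∞ M]
  [RiemannianBundle (fun x : M ↦ TangentSpace I x)]
  [IsContMDiffRiemannianBundle I ∞ E (fun x : M ↦ TangentSpace I x)]
  {cov : CovariantDerivative I E (fun x : M ↦ TangentSpace I x)}
  {X Y Z W : Π x : M, TangentSpace I x} {x : M}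

/-- The Levi-Civita connection preserves smoothness near a point; its smoothness is only assumed
for global vector fields, whence the cut-off. -/
theorem IsLeviCivita.smoothNear_cov [T2Space M] (hcov : IsLeviCivita cov)
    (hZ : SmoothNear Z x) (hY : SmoothNear Y x) : SmoothNear (fun y ↦ cov Z y (Y y)) x := by
  obtain ⟨Z', hZ', hZZ'⟩ := hZ.exists_contMDiff_eventuallyEq
  obtain ⟨Y', hY', hYY'⟩ := hY.exists_contMDiff_eventuallyEq
  have h := hcov.smooth.contMDiff.contMDiff (σ := Z') (by simpa using hZ'.contMDiffOn)
  rw [contMDiffOn_univ] at h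
  have h' : CMDiff ∞ (T% (fun y ↦ cov Z' y (Y' y))) := fun y ↦
    ContMDiffAt.clm_bundle_apply (h y) (hY' y)
  have heq : ∀ᶠ y in 𝓝 x, cov Z y (Y y) = cov Z' y (Y' y) := by
    filter_upwards [hZ.eventually, hZZ'.eventually_nhds, hYY'] with y hy hyZ hyY
    rw [hyY, cov.isCovariantDerivativeOnUniv.congr_of_eventuallyEq hy.mdifferentiableAt
      ((hZ' y).mdifferentiableAt (by simp)) univ_mem (hyZ.mono fun _ h ↦ h.symm)]
  filter_upwards [heq.eventually_nhds] with y hy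
  refine (h' y).congr_of_eventuallyEq ?_
  filter_upwards [hy] with z hz
  rw [hz]

theorem IsLeviCivita.mvfderiv_inner (hcov : IsLeviCivita cov)
    (hZ : MDiffAt (T% Z) x) (hW : MDiffAt (T% W) x) (v : TangentSpace I x) :
    mvfderiv I (fun y ↦ (inner ℝ (Z y) (W y) : ℝ)) x v
      = inner ℝ (cov Z x v) (W x) + inner ℝ (Z x) (cov W x v) := by
  simpa using hcov.metric.mvfderiv_inner_eq (FiberBundle.extend E v) hZ hW

theorem IsLeviCivita.mlieBracket_eq (hcov : IsLeviCivita cov)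
    (hX : MDiffAt (T% X) x) (hY : MDiffAt (T% Y) x) :
    mlieBracket I X Y x = cov Y x (X x) - cov X x (Y x) :=
  (cov.torsion_eq_zero_iff.1 hcov.torsion_free hX hY).symm

/-- The curvature endomorphism of a metric connection is skew-adjoint. -/
theorem IsLeviCivita.inner_curvature [T2Space M] [Nontrivial E] (hcov : IsLeviCivita cov)
    (hX : SmoothNear X x) (hY : SmoothNear Y x) (hZ : SmoothNear Z x) (hW : SmoothNear W x) :
    inner ℝ (curvature cov X Y Z x) (W x) = - inner ℝ (Z x) (curvature cov X Y W x) := by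
  -- For `f = g(Z, W)`, `X Y f - Y X f - [X, Y] f = 0` is expanded by metric compatibility; the
  -- products of first derivatives of `Z` and `W` are symmetric in `X`, `Y` and cancel.
  have hf : CMDiffAt ∞ (fun y ↦ (inner ℝ (Z y) (W y) : ℝ)) x :=
    ContMDiffAt.inner_bundle (F := E) (E := fun x : M ↦ TangentSpace I x)
      hZ.contMDiffAt hW.contMDiffAt
  have first : ∀ U : Π x : M, TangentSpace I x,
      (fun y ↦ mvfderiv I (fun y ↦ (inner ℝ (Z y) (W y) : ℝ)) y (U y)) =ᶠ[𝓝 x]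
        fun y ↦ inner ℝ (cov Z y (U y)) (W y) + inner ℝ (Z y) (cov W y (U y)) := by
    intro U
    filter_upwards [hZ.eventually, hW.eventually] with y hZy hWy
    exact hcov.mvfderiv_inner hZy.mdifferentiableAt hWy.mdifferentiableAt _
  have d1 : ∀ {U : Π x : M, TangentSpace I x}, SmoothNear U x →
      MDiffAt (fun y ↦ (inner ℝ (cov Z y (U y)) (W y) : ℝ)) x := fun hU ↦
    mdifferentiableAt_inner (hcov.smoothNear_cov hZ hU).mdifferentiableAt hW.mdifferentiableAt
  have d2 : ∀ {U : Π x : M, TangentSpace I x}, SmoothNear U x →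
      MDiffAt (fun y ↦ (inner ℝ (Z y) (cov W y (U y)) : ℝ)) x := fun hU ↦
    mdifferentiableAt_inner hZ.mdifferentiableAt (hcov.smoothNear_cov hW hU).mdifferentiableAt
  have second : ∀ {U : Π x : M, TangentSpace I x}, SmoothNear U x → ∀ v : TangentSpace I x,
      mvfderiv I (fun y ↦ mvfderiv I (fun y ↦ (inner ℝ (Z y) (W y) : ℝ)) y (U y)) x v
        = inner ℝ (cov (fun y ↦ cov Z y (U y)) x v) (W x)
          + inner ℝ (cov Z x (U x)) (cov W x v)
          + (inner ℝ (cov Z x v) (cov W x (U x))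
          + inner ℝ (Z x) (cov (fun y ↦ cov W y (U y)) x v)) := by
    intro U hU v
    rw [mvfderiv_congr (first U), mvfderiv_fun_add (d1 hU) (d2 hU)]
    simp only [add_apply]
    rw [hcov.mvfderiv_inner (hcov.smoothNear_cov hZ hU).mdifferentiableAt hW.mdifferentiableAt,
      hcov.mvfderiv_inner hZ.mdifferentiableAt (hcov.smoothNear_cov hW hU).mdifferentiableAt]
  have hd : ∀ {U : Π x : M, TangentSpace I x}, SmoothNear U x →
      MDiffAt (fun y ↦ mvfderiv I (fun y ↦ (inner ℝ (Z y) (W y) : ℝ)) y (U y)) x := fun hU ↦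
    ((d1 hU).add (d2 hU)).congr_of_eventuallyEq (first _)
  have h := mvfderiv_comm hX hY hf (hd hX) (hd hY)
  rw [second hX, second hY, hcov.mvfderiv_inner hZ.mdifferentiableAt hW.mdifferentiableAt] at h
  simp only [curvature, inner_sub_left, inner_sub_right]
  linarith

/-- The inner product of `R(X, Y) Z` with `W` at `x` only depends on `Z` through `Z x`. -/
theorem IsLeviCivita.inner_curvature_congr [T2Space M] [Nontrivial E] (hcov : IsLeviCivita cov)
    {Z' : Π x : M, TangentSpace I x}
    (hX : SmoothNear X x) (hY : SmoothNear Y x) (hZ : SmoothNear Z x) (hZ' : SmoothNear Z' x)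
    (hW : SmoothNear W x) (h : Z x = Z' x) :
    inner ℝ (curvature cov X Y Z x) (W x) = inner ℝ (curvature cov X Y Z' x) (W x) := by
  -- Skew-adjointness moves `Z` to a slot where it is not differentiated.
  rw [hcov.inner_curvature hX hY hZ hW, hcov.inner_curvature hX hY hZ' hW, h]

/-- `(L_V g)(v, w) = g(∇_v V, w) + g(v, ∇_w V)`. -/
theorem lieDerivMetric_eq (hcov : IsLeviCivita cov) {V : Π x : M, TangentSpace I x}
    (hV : MDiffAt (T% V) x) (v w : TangentSpace I x) :
    lieDerivMetric V x v w = inner ℝ (cov V x v) w + inner ℝ v (cov V x w) := by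
  have hX := (smoothNear_extend v).mdifferentiableAt
  have hY := (smoothNear_extend w).mdifferentiableAt
  simp only [lieDerivMetric]
  rw [hcov.mvfderiv_inner hX hY, hcov.mlieBracket_eq hV hX, hcov.mlieBracket_eq hV hY]
  simp only [FiberBundle.extend_apply_self, inner_sub_left, inner_sub_right]
  ring

end LeviCivita

/-! ### The unit field `ξ`. -/

section AlmostContact

variable {E : Type*} [NormedAddCommGroup E] [NormedSpace ℝ E]
  {H : Type*} [TopologicalSpace H] {I : ModelWithCorners ℝ E H}
  {M : Type*} [TopologicalSpace M] [ChartedSpace H M] [IsManifold I ∞ M]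
  [RiemannianBundle (fun x : M ↦ TangentSpace I x)]
  {φ : Π x : M, TangentSpace I x →L[ℝ] TangentSpace I x}
  {ξ : Π x : M, TangentSpace I x} {η : Π x : M, TangentSpace I x →L[ℝ] ℝ}

theorem IsAlmostContactMetric.smoothNear_xi (h : IsAlmostContactMetric φ ξ η) (x : M) :
    SmoothNear ξ x :=
  smoothNear_of_contMDiff h.smooth_xi x

theorem IsAlmostContactMetric.inner_xi_xi (h : IsAlmostContactMetric φ ξ η) (x : M) :
    (inner ℝ (ξ x) (ξ x) : ℝ) = 1 := by
  rw [← h.eta_eq, h.eta_xi]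

end AlmostContact

/-! ### Covariant derivative of `ξ` and the curvature `R(X, Y) ξ`. -/

section FKenmotsu

variable {E : Type*} [NormedAddCommGroup E] [NormedSpace ℝ E] [FiniteDimensional ℝ E]
  {H : Type*} [TopologicalSpace H] {I : ModelWithCorners ℝ E H}
  {M : Type*} [TopologicalSpace M] [ChartedSpace H M] [IsManifold I ∞ M]
  [RiemannianBundle (fun x : M ↦ TangentSpace I x)]
  [IsContMDiffRiemannianBundle I ∞ E (fun x : M ↦ TangentSpace I x)]
  {cov : CovariantDerivative I E (fun x : M ↦ TangentSpace I x)}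
  {φ : Π x : M, TangentSpace I x →L[ℝ] TangentSpace I x}
  {ξ : Π x : M, TangentSpace I x} {η : Π x : M, TangentSpace I x →L[ℝ] ℝ}
  {X Y : Π x : M, TangentSpace I x} {x : M}

/-- On an `f`-Kenmotsu manifold, `∇_v ξ = f (v - η(v) ξ)`. -/
theorem IsFKenmotsu.cov_xi {f : M → ℝ} (h : IsFKenmotsu cov φ ξ η f) (x : M)
    (v : TangentSpace I x) : cov ξ x v = f x • (v - η x v • ξ x) := by
  have hac := h.almostContact
  have hd := (hac.smoothNear_xi x).mdifferentiableAt
  have h1 := h.covDeriv_phi ξ hac.smooth_xi x v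
  have hφξ : (fun y ↦ φ y (ξ y)) = 0 := funext hac.phi_xi
  -- `ξ` has constant length, so `∇_v ξ` is orthogonal to it.
  have hη : η x (cov ξ x v) = 0 := by
    have h2 := h.leviCivita.mvfderiv_inner hd hd v
    have h3 : (fun y ↦ (inner ℝ (ξ y) (ξ y) : ℝ)) = fun _ ↦ 1 := funext hac.inner_xi_xi
    rw [h3, mvfderiv_const, real_inner_comm (cov ξ x v)] at h2
    rw [hac.eta_eq]
    simp only [zero_apply] at h2
    linarith
  have h4 : φ x (cov ξ x v) = f x • φ x v := by
    rw [hφξ, CovariantDerivative.zero, ← hac.eta_eq, hac.eta_phi, hac.eta_xi] at h1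
    simpa using h1
  -- `φ` is invertible on the orthogonal complement of `ξ`: applying it again recovers `∇_v ξ`.
  have h5 := congrArg (φ x) h4
  rw [map_smul, hac.phi_phi, hac.phi_phi, hη, zero_smul, add_zero] at h5
  rw [← neg_eq_iff_eq_neg.2 h5.symm]
  module

variable {β : ℝ}

/-- On a `β`-Kenmotsu manifold, `R(X, Y) ξ = β² (η(X) Y - η(Y) X)`. -/
theorem IsBetaKenmotsu.curvature_xi (h : IsBetaKenmotsu cov φ ξ η β)
    (hX : SmoothNear X x) (hY : SmoothNear Y x) :
    curvature cov X Y ξ x = β ^ 2 • (η x (X x) • Y x - η x (Y x) • X x) := by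
  have hac := h.almostContact
  have hξ := (hac.smoothNear_xi x).mdifferentiableAt
  have second : ∀ {U : Π x : M, TangentSpace I x}, SmoothNear U x → ∀ v : TangentSpace I x,
      cov (fun y ↦ cov ξ y (U y)) x v = β • cov U x v - (β * η x (U x)) • cov ξ x v
        - (β * (η x (cov U x v) + inner ℝ (U x) (cov ξ x v))) • ξ x := by
    intro U hU v
    have hU' := hU.mdifferentiableAt
    have hin : MDiffAt (fun y ↦ (inner ℝ (U y) (ξ y) : ℝ)) x := mdifferentiableAt_inner hU' hξ
    -- Writing `η(U)` as `g(U, ξ)` lets metric compatibility differentiate it.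
    have hfield : (fun y ↦ cov ξ y (U y))
        = (fun _ : M ↦ β) • U + ((fun _ : M ↦ -β) * fun y ↦ (inner ℝ (U y) (ξ y) : ℝ)) • ξ := by
      funext y
      rw [h.cov_xi, hac.eta_eq]
      simp only [Pi.add_apply, Pi.smul_apply', Pi.mul_apply]
      module
    have hβ : MDiffAt (fun _ : M ↦ β) x := mdifferentiableAt_const
    have hβ' : MDiffAt (fun _ : M ↦ -β) x := mdifferentiableAt_const
    have hco := cov.isCovariantDerivativeOnUniv
    rw [hfield, hco.add (hβ.smul_section hU') ((hβ'.mul hin).smul_section hξ),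
      hco.leibniz hU' hβ, hco.leibniz hξ (hβ'.mul hin), mvfderiv_mul hβ' hin,
      mvfderiv_const, mvfderiv_const]
    simp only [add_apply, smul_apply,
      ContinuousLinearMap.smulRight_apply, zero_apply,
      h.leviCivita.mvfderiv_inner hU' hξ, Pi.mul_apply, hac.eta_eq]
    module
  -- Torsion-freeness cancels the derivatives of `X` and `Y`; the terms `g(U, ∇_v ξ)` are symmetric
  -- and drop out.
  rw [curvature, second hX, second hY, h.cov_xi, h.cov_xi, h.cov_xi,
    h.leviCivita.mlieBracket_eq hX.mdifferentiableAt hY.mdifferentiableAt]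
  simp only [map_sub, inner_smul_right, inner_sub_right, ← hac.eta_eq,
    real_inner_comm (X x) (Y x)]
  module

end FKenmotsu

/-! ### Ricci tensor on `ξ`, and the soliton equation at a point. -/

section Soliton

variable {E : Type*} [NormedAddCommGroup E] [NormedSpace ℝ E] [FiniteDimensional ℝ E]
  {H : Type*} [TopologicalSpace H] {I : ModelWithCorners ℝ E H}
  {M : Type*} [TopologicalSpace M] [ChartedSpace H M] [IsManifold I ∞ M]
  [RiemannianBundle (fun x : M ↦ TangentSpace I x)]
  [IsContMDiffRiemannianBundle I ∞ E (fun x : M ↦ TangentSpace I x)]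
  {cov : CovariantDerivative I E (fun x : M ↦ TangentSpace I x)}
  {φ : Π x : M, TangentSpace I x →L[ℝ] TangentSpace I x}
  {ξ : Π x : M, TangentSpace I x} {η : Π x : M, TangentSpace I x →L[ℝ] ℝ} {β lam : ℝ}

theorem sum_inner_self_orthonormalBasis {ι V : Type*} [Fintype ι] [NormedAddCommGroup V]
    [InnerProductSpace ℝ V] (e : OrthonormalBasis ι ℝ V) :
    ∑ i, (inner ℝ (e i) (e i) : ℝ) = Fintype.card ι := by
  simp

/-- On a `β`-Kenmotsu manifold of dimension `n`, `S(v, ξ) = -(n - 1) β² η(v)`. -/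
theorem IsBetaKenmotsu.ricci_xi [T2Space M] [Nontrivial E]
    (h : IsBetaKenmotsu cov φ ξ η β) (x : M)
    (v : TangentSpace I x) :
    ricci cov x v (ξ x) = β ^ 2 * (1 - Module.finrank ℝ E) * η x v := by
  have hac := h.almostContact
  have : FiniteDimensional ℝ (TangentSpace I x) := inferInstanceAs (FiniteDimensional ℝ E)
  have hdim : Module.finrank ℝ (TangentSpace I x) = Module.finrank ℝ E := rfl
  simp only [ricci]
  set e := stdOrthonormalBasis ℝ (TangentSpace I x)
  have hterm : ∀ i, (inner ℝ (curvature cov (FiberBundle.extend E (e i))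
      (FiberBundle.extend E v) (FiberBundle.extend E (ξ x)) x) (e i) : ℝ)
      = β ^ 2 * (inner ℝ v (e i) * inner ℝ (e i) (ξ x) - η x v * inner ℝ (e i) (e i)) := by
    intro i
    -- The extension of `ξ x` is replaced by `ξ` itself, to which `curvature_xi` applies.
    have hi := h.leviCivita.inner_curvature_congr (smoothNear_extend (e i)) (smoothNear_extend v)
      (smoothNear_extend (ξ x)) (hac.smoothNear_xi x) (smoothNear_extend (e i))
      (FiberBundle.extend_apply_self E (ξ x))
    rw [FiberBundle.extend_apply_self] at hi
    rw [hi, h.curvature_xi (smoothNear_extend (e i)) (smoothNear_extend v)]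
    simp only [FiberBundle.extend_apply_self, inner_smul_left, inner_sub_left, hac.eta_eq,
      RCLike.conj_to_real]
    ring
  rw [Finset.sum_congr rfl fun i _ ↦ hterm i, ← Finset.mul_sum, Finset.sum_sub_distrib,
    ← Finset.mul_sum, e.sum_inner_mul_inner, sum_inner_self_orthonormalBasis, ← hac.eta_eq,
    Fintype.card_fin, hdim]
  ring

/-- On a `β`-Kenmotsu manifold, `L_ξ g = 2 β (g - η ⊗ η)`. -/
theorem IsBetaKenmotsu.lieDerivMetric_xi (h : IsBetaKenmotsu cov φ ξ η β) (x : M)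
    (v w : TangentSpace I x) :
    lieDerivMetric ξ x v w = 2 * β * (inner ℝ v w - η x v * η x w) := by
  have hac := h.almostContact
  rw [lieDerivMetric_eq h.leviCivita (hac.smoothNear_xi x).mdifferentiableAt, h.cov_xi, h.cov_xi]
  simp only [inner_smul_left, inner_smul_right, inner_sub_left, inner_sub_right,
    RCLike.conj_to_real, hac.eta_eq, real_inner_comm w (ξ x)]
  ring

/-- The soliton equation at a single point, evaluated on `(ξ, ξ)`, determines `λ`. -/
theorem IsBetaKenmotsu.soliton_constant [T2Space M] [Nontrivial E]
    (h : IsBetaKenmotsu cov φ ξ η β) {x : M}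
    (hs : RicciSolitonEquationAt cov ξ lam x) : lam = (Module.finrank ℝ E - 1) * β ^ 2 := by
  have hac := h.almostContact
  have h1 := hs (ξ x) (ξ x)
  rw [h.lieDerivMetric_xi, h.ricci_xi, hac.inner_xi_xi, hac.eta_xi] at h1
  linarith

/-- The trace of the soliton equation at a single point determines the scalar curvature. -/
theorem IsBetaKenmotsu.scalarCurvature_eq (h : IsBetaKenmotsu cov φ ξ η β) {x : M}
    (hs : RicciSolitonEquationAt cov ξ lam x) :
    scalarCurvature cov x
      = -(Module.finrank ℝ E - 1) * β - lam * Module.finrank ℝ E := by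
  have hac := h.almostContact
  have : FiniteDimensional ℝ (TangentSpace I x) := inferInstanceAs (FiniteDimensional ℝ E)
  have hdim : Module.finrank ℝ (TangentSpace I x) = Module.finrank ℝ E := rfl
  simp only [scalarCurvature]
  set e := stdOrthonormalBasis ℝ (TangentSpace I x)
  have hterm : ∀ i, ricci cov x (e i) (e i)
      = β * (inner ℝ (ξ x) (e i) * inner ℝ (e i) (ξ x)) - (β + lam) * inner ℝ (e i) (e i) := by
    intro i
    have h1 := hs (e i) (e i)
    rw [h.lieDerivMetric_xi, hac.eta_eq] at h1
    rw [real_inner_comm (e i) (ξ x)]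
    linarith
  rw [Finset.sum_congr rfl fun i _ ↦ hterm i, Finset.sum_sub_distrib,
    ← Finset.mul_sum, ← Finset.mul_sum, e.sum_inner_mul_inner, sum_inner_self_orthonormalBasis,
    hac.inner_xi_xi, Fintype.card_fin, hdim]
  ring

end Soliton

end Kenmotsu

theorem proposition3
    {M : Type*} [TopologicalSpace M] [T2Space M] [SecondCountableTopology M] [Nonempty M]
    [ChartedSpace (EuclideanSpace ℝ (Fin 3)) M] [IsManifold (𝓡 3) ∞ M]
    [RiemannianBundle (fun x : M ↦ TangentSpace (𝓡 3) x)]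
    [IsContMDiffRiemannianBundle (𝓡 3) ∞ (EuclideanSpace ℝ (Fin 3))
      (fun x : M ↦ TangentSpace (𝓡 3) x)]
    (cov : CovariantDerivative (𝓡 3) (EuclideanSpace ℝ (Fin 3))
      (fun x : M ↦ TangentSpace (𝓡 3) x))
    (φ : Π x : M, TangentSpace (𝓡 3) x →L[ℝ] TangentSpace (𝓡 3) x)
    (ξ : Π x : M, TangentSpace (𝓡 3) x)
    (η : Π x : M, TangentSpace (𝓡 3) x →L[ℝ] ℝ)
    (β lam : ℝ)
    (hK : Kenmotsu.IsBetaKenmotsu cov φ ξ η β) :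
    (Kenmotsu.IsRicciSoliton cov ξ lam →
      Kenmotsu.IsExpanding lam ∧ lam = 2 * β ^ 2 ∧
        ∃ r : ℝ, ∀ x : M, Kenmotsu.scalarCurvature cov x = r) ∧
    (∀ x : M, Kenmotsu.RicciSolitonEquationAt cov ξ lam x →
      lam = 2 * β ^ 2 ∧ Kenmotsu.scalarCurvature cov x = -6 * β ^ 2 - 2 * β) := by
  have hlam : ∀ x : M, Kenmotsu.RicciSolitonEquationAt cov ξ lam x → lam = 2 * β ^ 2 := by
    intro x hx
    rw [hK.soliton_constant hx, finrank_euclideanSpace_fin]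
    norm_num
  have hscal : ∀ x : M, Kenmotsu.RicciSolitonEquationAt cov ξ lam x →
      Kenmotsu.scalarCurvature cov x = -6 * β ^ 2 - 2 * β := by
    intro x hx
    rw [hK.scalarCurvature_eq hx, finrank_euclideanSpace_fin, hlam x hx]
    push_cast
    ring
  refine ⟨fun hs ↦ ?_, fun x hx ↦ ⟨hlam x hx, hscal x hx⟩⟩
  -- One point suffices to determine `λ` and the sign of `β`.
  have hx := hlam (Classical.arbitrary M) (hs.equation _)
  have hβ : 0 < β := hK.pos (Classical.arbitrary M)
  exact ⟨by rw [Kenmotsu.IsExpanding, hx]; positivity, hx, _, fun x ↦ hscal x (hs.equation x)⟩
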